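/- Let $\mathcal H$ be a finite-dimensional complex Hilbert space, and for an operator $X$ on $\mathcal H$ and a real $p\ge 1$ let $\|X\|_p=[\operatorname{Tr}\{|X|^p\}]^{1/p}$, with $|X|=\sqrt{X^*X}$, be its Schatten $p$-norm. Let $C_1,\ldots,C_L$ be positive semi-definite operators on $\mathcal H$. Then for every real $p\ge 1$ the maximum $$ f(p)=\max_{V_{C_1},\ldots,V_{C_L}}\left\Vert C_1^{1/p}V_{C_1}\cdots C_L^{1/p}V_{C_L}\right\Vert_p^p , $$ where each $V_{C_i}$ ranges over all unitary operators on $\mathcal H$ that commute with $C_i$, is attained, and $f$ is monotone non-increasing on $[1,\infty)$: if $1\le q\le p$, then $f(p)\le f(q)$. -/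

import Mathlib

open Set

noncomputable section

/-- The Schatten `p`-norm `‖X‖_p = (Tr |X| ^ p) ^ (1 / p)` of an operator `X` on a complex
Hilbert space `H` of finite dimension, where `|X| = (X* X) ^ (1 / 2)` and `|X| ^ p` are taken in the
continuous functional calculus. The trace of the positive operator `|X| ^ p` is a nonnegative
real number, which is read off from the complex trace by its real part. -/
def schattenNorm {H : Type*} [NormedAddCommGroup H] [InnerProductSpace ℂ H] [CompleteSpace H]
    [FiniteDimensional ℂ H] (p : ℝ) (X : H →L[ℂ] H) : ℝ :=
  (LinearMap.trace ℂ H ((CFC.abs X ^ p : H →L[ℂ] H) : H →ₗ[ℂ] H)).re ^ (1 / p)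

/-- The ordered product `C₁ ^ (1 / p) V₁ ⋯ C_L ^ (1 / p) V_L`. -/
def swivelProduct {H : Type*} [NormedAddCommGroup H] [InnerProductSpace ℂ H] [CompleteSpace H]
    {L : ℕ} (C : Fin L → H →L[ℂ] H) (p : ℝ) (V : Fin L → unitary (H →L[ℂ] H)) : H →L[ℂ] H :=
  (List.ofFn fun i => C i ^ (1 / p) * (V i : H →L[ℂ] H)).prod

/-- The set of all numbers `‖C₁ ^ (1 / p) V₁ ⋯ C_L ^ (1 / p) V_L‖_p ^ p`, where each `V_i` ranges
over the unitaries that commute with `C_i`. -/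
def swivelValues {H : Type*} [NormedAddCommGroup H] [InnerProductSpace ℂ H] [CompleteSpace H]
    [FiniteDimensional ℂ H] {L : ℕ} (C : Fin L → H →L[ℂ] H) (p : ℝ) : Set ℝ :=
  {x | ∃ V : Fin L → unitary (H →L[ℂ] H),
    (∀ i, Commute (V i : H →L[ℂ] H) (C i)) ∧ x = schattenNorm p (swivelProduct C p V) ^ p}

/-- The maximum over the unitary swivels, as a supremum of real numbers. -/
def maxSwivel {H : Type*} [NormedAddCommGroup H] [InnerProductSpace ℂ H] [CompleteSpace H]
    [FiniteDimensional ℂ H] {L : ℕ} (C : Fin L → H →L[ℂ] H) (p : ℝ) : ℝ :=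
  sSup (swivelValues C p)

end

/-!
The monotonicity is a complex interpolation argument, carried out with the Hadamard three lines
theorem. For a positive operator `a` and a complex number `z` let `cpowSupp a z` be the power
`a ^ z`, set to `0` on the kernel of `a`; it is entire in `z`, and it is a contraction for
`re z = 0`.

Let `1 ≤ q ≤ p`, let `X = ∏ C_i ^ (1 / p) V_i`, let `U` be the partial isometry of its polar
decomposition, `D = |X| ^ p` and `N = Tr D`. Consider the entire function
`F z = Tr (∏ C_i ^ (z / q) V_i * D ^ (1 - z / q) * U*)`, which is bounded on the strip
`0 ≤ re z ≤ 1`.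
* At `z = q / p` its value is `Tr (U* X |X| ^ (p - 1)) = N`.
* On `re z = 0` the product is a contraction, and so `|F z| ≤ N`.
* On `re z = 1` each `C_i ^ (z / q)` is `C_i ^ (1 / q)` times a unitary that commutes with `C_i`
  (`exists_unitary_cpowSupp`): the product is one of those that enter the maximum `M` for the
  exponent `q`, and Hölder's inequality for the trace (`norm_opTrace_holder`) gives
  `|F z| ≤ N ^ (1 - 1 / q) * M ^ (1 / q)`.

The three lines theorem then says
`N ≤ N ^ (1 - q / p) * (N ^ (1 - 1 / q) * M ^ (1 / q)) ^ (q / p)`, which rearranges to `N ≤ M`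
(`opTrace_swivelProduct_le`). Hölder's inequality is itself obtained by interpolating
`Tr (U P ^ z D ^ (1 - z) W)` in the same way, between two instances of `|Tr (M D)| ≤ ‖M‖ Tr D`.

The maximum is attained because the unitaries that commute with a given operator form a compact
set and `X ↦ Tr (|X| ^ p)` is continuous.
-/

set_option linter.unusedSectionVars false

noncomputable section

/-! ### Complex powers of a positive operator -/

section SpectralPowers
variable {H : Type*} [NormedAddCommGroup H] [InnerProductSpace ℂ H] [CompleteSpace H]
  [FiniteDimensional ℂ H]

theorem finite_spectrum_clm (a : H →L[ℂ] H) : (spectrum ℂ a).Finite := by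
  have h := AlgEquiv.spectrum_eq (Module.End.toContinuousLinearMap H (𝕜 := ℂ)).symm a
  rw [← h]
  exact Module.End.finite_spectrum _

theorem continuousOn_spectrum (f : ℂ → ℂ) (a : H →L[ℂ] H) : ContinuousOn f (spectrum ℂ a) :=
  (finite_spectrum_clm a).continuousOn f

theorem exists_of_mem_spectrum_of_nonneg {a : H →L[ℂ] H} (ha : 0 ≤ a) {x : ℂ}
    (hx : x ∈ spectrum ℂ a) : ∃ r : ℝ, 0 ≤ r ∧ x = r := by
  have h1 : x = x.re := (IsSelfAdjoint.of_nonneg ha).mem_spectrum_eq_re hx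
  have h2 : x.re ∈ spectrum ℝ a := by
    rw [h1] at hx
    exact spectrum.algebraMap_mem_iff ℂ |>.mp hx
  exact ⟨x.re, spectrum_nonneg_of_nonneg ha h2, h1⟩

/-- The function `x ↦ x ^ z`, with value `0` at `x = 0` for every `z`, also for `z = 0`. This
choice makes the exponents additive without exception. -/
def suppPow (z x : ℂ) : ℂ := if x = 0 then 0 else x ^ z

/-- The complex power `a ^ z` of `a` on its support, and `0` on its kernel. The spectrum is
finite, so this is entire in `z`; `cpowSupp a 0` is the projection to the support of `a`. -/
def cpowSupp (a : H →L[ℂ] H) (z : ℂ) : H →L[ℂ] H := cfc (suppPow z) a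

theorem cpowSupp_mul_cpowSupp {a : H →L[ℂ] H} (z w : ℂ) :
    cpowSupp a z * cpowSupp a w = cpowSupp a (z + w) := by
  unfold cpowSupp
  rw [← cfc_mul _ _ a (continuousOn_spectrum _ _) (continuousOn_spectrum _ _)]
  congr 1
  ext x
  by_cases hx : x = 0
  · simp [suppPow, hx]
  · simp [suppPow, hx, Complex.cpow_add]

theorem rpow_eq_cfc_complex {a : H →L[ℂ] H} (ha : 0 ≤ a) (r : ℝ) :
    a ^ r = cfc (fun x : ℂ => ((x.re ^ r : ℝ) : ℂ)) a := by
  rw [CFC.rpow_eq_cfc_real ha, cfc_real_eq_complex _ (IsSelfAdjoint.of_nonneg ha)]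

theorem cpowSupp_ofReal {a : H →L[ℂ] H} (ha : 0 ≤ a) {r : ℝ} (hr : 0 < r) :
    cpowSupp a r = a ^ r := by
  rw [rpow_eq_cfc_complex ha, cpowSupp]
  refine cfc_congr fun x hx => ?_
  obtain ⟨t, ht, rfl⟩ := exists_of_mem_spectrum_of_nonneg ha hx
  by_cases h : t = 0
  · simp [suppPow, h, Real.zero_rpow hr.ne']
  · simp [suppPow, h, Complex.ofReal_cpow ht]

theorem cpowSupp_one {a : H →L[ℂ] H} (ha : 0 ≤ a) : cpowSupp a 1 = a := by
  have := cpowSupp_ofReal ha one_pos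
  rwa [CFC.rpow_one a ha, Complex.ofReal_one] at this

theorem cpowSupp_one_add {a : H →L[ℂ] H} (ha : 0 ≤ a) (w : ℂ) :
    cpowSupp a (1 + w) = a * cpowSupp a w := by
  rw [← cpowSupp_mul_cpowSupp, cpowSupp_one ha]

theorem cpowSupp_rpow_one_div {a : H →L[ℂ] H} (ha : 0 ≤ a) {q : ℝ} (hq : 0 < q) :
    cpowSupp (a ^ q) (1 / q : ℝ) = a := by
  have h0 : 0 ≤ a ^ q := CFC.rpow_nonneg
  have h1 : 0 < 1 / q := one_div_pos.mpr hq
  rw [cpowSupp_ofReal h0 h1, CFC.rpow_rpow_of_exponent_nonneg a q (1 / q) hq.le h1.le ha,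
    mul_one_div_cancel hq.ne', CFC.rpow_one _ ha]

theorem norm_cpowSupp_le {a : H →L[ℂ] H} (ha : 0 ≤ a) (z : ℂ) {R : ℝ} (h0 : 0 ≤ z.re)
    (hR : z.re ≤ R) : ‖cpowSupp a z‖ ≤ (max 1 (‖a‖ * ‖(1 : H →L[ℂ] H)‖)) ^ R := by
  refine norm_cfc_le (by positivity) fun x hx => ?_
  have hxn := spectrum.norm_le_norm_mul_of_mem hx
  obtain ⟨t, ht, rfl⟩ := exists_of_mem_spectrum_of_nonneg ha hx
  by_cases h : t = 0
  · simp only [suppPow, h, Complex.ofReal_zero, if_true, norm_zero]; positivity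
  · have htp : 0 < t := lt_of_le_of_ne ht (Ne.symm h)
    simp only [suppPow, Complex.ofReal_eq_zero, h, if_false]
    rw [Complex.norm_cpow_eq_rpow_re_of_pos htp]
    rw [Complex.norm_real, Real.norm_of_nonneg ht] at hxn
    calc t ^ z.re ≤ (max 1 (‖a‖ * ‖(1 : H →L[ℂ] H)‖)) ^ z.re :=
          Real.rpow_le_rpow ht (le_max_of_le_right hxn) h0
      _ ≤ _ := Real.rpow_le_rpow_of_exponent_le (le_max_left _ _) hR

theorem norm_cpowSupp_le_one {a : H →L[ℂ] H} (ha : 0 ≤ a) {z : ℂ} (h0 : z.re = 0) :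
    ‖cpowSupp a z‖ ≤ 1 := by
  simpa using norm_cpowSupp_le ha z (R := 0) h0.ge h0.le

/-- On the finite spectrum, `cpowSupp a z` is the sum of the scalars `y ^ z` times the spectral
projections of `a`, and each summand is entire. -/
theorem differentiable_cpowSupp (a : H →L[ℂ] H) :
    Differentiable ℂ (cpowSupp a) := by
  have key : cpowSupp a = fun z => ∑ y ∈ (finite_spectrum_clm a).toFinset,
      suppPow z y • cfc (fun x => if x = y then (1 : ℂ) else 0) a := by
    funext z
    simp_rw [← cfc_smul _ _ a (continuousOn_spectrum _ a)]
    rw [← cfc_sum _ a _ (fun i _ => continuousOn_spectrum _ a), cpowSupp]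
    refine cfc_congr fun x hx => ?_
    simp [Finset.sum_apply, hx]
  rw [key]
  refine Differentiable.fun_sum fun y _ => Differentiable.smul_const ?_ _
  unfold suppPow
  by_cases hy : y = 0
  · simp [hy]
  · simp only [hy, if_false]
    intro z
    exact (differentiableAt_id).const_cpow (Or.inl hy)

/-- For `re z = r > 0` the power `a ^ z` differs from `a ^ r` by a unitary that commutes with `a`:
the phase `a ^ (i im z)` on the support of `a`, continued by the identity on the kernel, where
`a ^ r` vanishes. -/
theorem exists_unitary_cpowSupp {a : H →L[ℂ] H} (ha : 0 ≤ a) {r : ℝ} (hr : 0 < r) {z : ℂ}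
    (hz : z.re = r) :
    ∃ u : unitary (H →L[ℂ] H), Commute (u : H →L[ℂ] H) a ∧ cpowSupp a z = a ^ r * u := by
  have hn : IsStarNormal a := (IsSelfAdjoint.of_nonneg ha).isStarNormal
  let g : ℂ → ℂ := fun x => if x = 0 then 1 else x ^ (z.im * Complex.I)
  have hg : cfc g a ∈ unitary (H →L[ℂ] H) := by
    rw [cfc_unitary_iff g a hn (continuousOn_spectrum _ _)]
    intro x hx
    obtain ⟨t, ht, rfl⟩ := exists_of_mem_spectrum_of_nonneg ha hx
    have : ‖g t‖ = 1 := by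
      by_cases h : t = 0
      · simp [g, h]
      · simp only [g, Complex.ofReal_eq_zero, h, if_false]
        rw [Complex.norm_cpow_eq_rpow_re_of_pos (lt_of_le_of_ne ht (Ne.symm h))]
        simp
    rw [← starRingEnd_apply, mul_comm, Complex.mul_conj']
    simp [this]
  refine ⟨⟨cfc g a, hg⟩, ?_, ?_⟩
  · have := cfc_commute_cfc g id a
    rwa [cfc_id ℂ a hn] at this
  · rw [← cpowSupp_ofReal ha hr]
    unfold cpowSupp
    simp only
    rw [← cfc_mul _ _ a (continuousOn_spectrum _ _) (continuousOn_spectrum _ _)]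
    congr 1
    ext x
    by_cases hx : x = 0
    · simp [suppPow, hx]
    · simp only [suppPow, g, hx, if_false]
      rw [← Complex.cpow_add _ _ hx, ← hz, Complex.re_add_im]

/-- Polar decomposition: `U = X |X|⁻¹`, with the inverse taken on the support of `|X|`. -/
theorem exists_polar (X : H →L[ℂ] H) :
    ∃ U : H →L[ℂ] H, ‖U‖ ≤ 1 ∧ U * CFC.abs X = X ∧ star U * X = CFC.abs X := by
  set a := CFC.abs X with ha
  have h0 : 0 ≤ a := CFC.abs_nonneg X
  have hn : IsStarNormal a := (IsSelfAdjoint.of_nonneg h0).isStarNormal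
  have hsa : star a = a := (IsSelfAdjoint.of_nonneg h0).star_eq
  have hXX : star X * X = a * a := (CFC.abs_mul_abs X).symm
  let b : H →L[ℂ] H := cpowSupp a (-1)
  have hb : star b = b := by
    simp only [b, cpowSupp]
    rw [← cfc_star]
    refine cfc_congr fun x hx => ?_
    obtain ⟨t, -, rfl⟩ := exists_of_mem_spectrum_of_nonneg h0 hx
    by_cases h : t = 0 <;> simp [suppPow, h, Complex.cpow_neg_one]
  have hid : cpowSupp a 1 = a := cpowSupp_one h0
  have hba : b * a = cpowSupp a 0 :=
    calc b * a = cpowSupp a (-1) * cpowSupp a 1 := by rw [hid]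
      _ = cpowSupp a 0 := by rw [cpowSupp_mul_cpowSupp, neg_add_cancel]
  have hab : a * b = b * a :=
    calc a * b = cpowSupp a 1 * cpowSupp a (-1) := by rw [hid]
      _ = b * a := by rw [cpowSupp_mul_cpowSupp, add_neg_cancel, hba]
  have haba : b * a * a = a :=
    calc b * a * a = cpowSupp a 0 * cpowSupp a 1 := by rw [hid, hba]
      _ = a := by rw [cpowSupp_mul_cpowSupp, zero_add, hid]
  -- `b * a` is the projection to the support of `|X|`, and `X` vanishes on its complement, since
  -- the absolute square of `X * (b * a) - X` is `0`.
  have hXP : X * (b * a) = X := by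
    rw [← sub_eq_zero, ← CStarRing.star_mul_self_eq_zero_iff]
    have e1 : a * (b * a) = a := by rw [← mul_assoc, hab, haba]
    have e2 : a * b * a = a := by rw [mul_assoc, e1]
    have : star (X * (b * a) - X) * (X * (b * a) - X)
        = a * b * (star X * X) * (b * a) - a * b * (star X * X) - (star X * X) * (b * a)
          + star X * X := by
      simp only [star_sub, star_mul, hsa, hb]; noncomm_ring
    rw [this, hXX]
    have e3 : a * b * (a * a) = a * a := by rw [← mul_assoc, e2]
    have e4 : a * a * (b * a) = a * a := by rw [mul_assoc, e1]
    rw [e3, e4]; abel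
  refine ⟨X * b, ?_, ?_, ?_⟩
  · have h1 : star (X * b) * (X * b) = b * a * (b * a) := by
      have : star (X * b) * (X * b) = b * (star X * X) * b := by
        simp only [star_mul, hb]; noncomm_ring
      rw [this, hXX, ← mul_assoc, mul_assoc, hab]
    have h2 : ‖b * a‖ ≤ 1 := by
      rw [hba]
      exact norm_cpowSupp_le_one h0 Complex.zero_re
    have h3 : ‖X * b‖ * ‖X * b‖ ≤ 1 := by
      rw [← CStarRing.norm_star_mul_self, h1]
      exact (norm_mul_le _ _).trans (mul_le_one₀ h2 (norm_nonneg _) h2)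
    nlinarith [norm_nonneg (X * b)]
  · rw [mul_assoc, hXP]
  · rw [star_mul, hb, mul_assoc, hXX, ← mul_assoc, haba]

end SpectralPowers

/-! ### Trace inequalities -/

section Trace
variable {H : Type*} [NormedAddCommGroup H] [InnerProductSpace ℂ H] [CompleteSpace H]
  [FiniteDimensional ℂ H]

/-- The trace, as a continuous linear functional on operators. -/
def opTrace (H : Type*) [NormedAddCommGroup H] [InnerProductSpace ℂ H] [CompleteSpace H]
    [FiniteDimensional ℂ H] : (H →L[ℂ] H) →L[ℂ] ℂ :=
  LinearMap.toContinuousLinearMap (LinearMap.trace ℂ H ∘ₗ ContinuousLinearMap.coeLM ℂ)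

theorem opTrace_apply (X : H →L[ℂ] H) : opTrace H X = LinearMap.trace ℂ H (X : H →ₗ[ℂ] H) := rfl

theorem opTrace_mul_comm (X Y : H →L[ℂ] H) : opTrace H (X * Y) = opTrace H (Y * X) :=
  LinearMap.trace_mul_comm ℂ (X : H →ₗ[ℂ] H) (Y : H →ₗ[ℂ] H)

theorem exists_eigenbasis {D : H →L[ℂ] H} (hD : 0 ≤ D) :
    ∃ (b : OrthonormalBasis (Fin (Module.finrank ℂ H)) ℂ H) (l : Fin (Module.finrank ℂ H) → ℝ),
      (∀ i, 0 ≤ l i) ∧ ∀ i, D (b i) = (l i : ℂ) • b i := by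
  have hp : D.IsPositive := ContinuousLinearMap.nonneg_iff_isPositive D |>.mp hD
  have hs : (D : H →ₗ[ℂ] H).IsSymmetric := hp.isSymmetric
  have hlp : (D : H →ₗ[ℂ] H).IsPositive := hp.toLinearMap
  exact ⟨hs.eigenvectorBasis rfl, hs.eigenvalues rfl, fun i => hlp.nonneg_eigenvalues rfl i,
    fun i => hs.apply_eigenvectorBasis rfl i⟩

theorem opTrace_mul_eq_sum (M D : H →L[ℂ] H) {ι : Type*} [Fintype ι] (b : OrthonormalBasis ι ℂ H)
    (l : ι → ℝ) (hl : ∀ i, D (b i) = (l i : ℂ) • b i) :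
    opTrace H (M * D) = ∑ i, (l i : ℂ) * inner ℂ (b i) (M (b i)) := by
  rw [opTrace_apply, LinearMap.trace_eq_sum_inner _ b]
  refine Finset.sum_congr rfl fun i _ => ?_
  have h : (M * D) (b i) = (l i : ℂ) • M (b i) := by
    rw [mul_apply_eq_comp, hl, map_smul]
  rw [ContinuousLinearMap.coe_coe, h, inner_smul_right]

theorem opTrace_eq_re_of_nonneg {D : H →L[ℂ] H} (hD : 0 ≤ D) :
    0 ≤ (opTrace H D).re ∧ opTrace H D = ((opTrace H D).re : ℂ) := by
  obtain ⟨b, l, hl0, hl⟩ := exists_eigenbasis hD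
  have h := opTrace_mul_eq_sum 1 D b l hl
  have h' : opTrace H D = ((∑ i, l i : ℝ) : ℂ) := by
    simpa using h
  rw [h']
  exact ⟨by simpa using Finset.sum_nonneg fun i _ => hl0 i, by simp⟩

/-- The duality between the trace norm and the operator norm, for a positive `D`; computed in an
orthonormal eigenbasis of `D`. -/
theorem norm_opTrace_mul_le {D : H →L[ℂ] H} (hD : 0 ≤ D) {M : H →L[ℂ] H} (hM : ‖M‖ ≤ 1) :
    ‖opTrace H (M * D)‖ ≤ (opTrace H D).re := by
  obtain ⟨b, l, hl0, hl⟩ := exists_eigenbasis hD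
  have h := opTrace_mul_eq_sum 1 D b l hl
  have h' : opTrace H D = ((∑ i, l i : ℝ) : ℂ) := by
    simpa using h
  rw [opTrace_mul_eq_sum M D b l hl, h', Complex.ofReal_re]
  refine (norm_sum_le _ _).trans (Finset.sum_le_sum fun i _ => ?_)
  rw [norm_mul, Complex.norm_real, Real.norm_of_nonneg (hl0 i)]
  refine mul_le_of_le_one_right (hl0 i) ((norm_inner_le_norm _ _).trans ?_)
  have := M.le_of_opNorm_le hM (b i)
  simpa using this

/-- Hadamard's three lines theorem on `0 ≤ re z ≤ 1`, for an entire function. -/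
theorem three_lines {F : ℂ → ℂ} (hF : Differentiable ℂ F) {B a b : ℝ}
    (hB : ∀ z : ℂ, 0 ≤ z.re → z.re ≤ 1 → ‖F z‖ ≤ B) (ha : ∀ z : ℂ, z.re = 0 → ‖F z‖ ≤ a)
    (hb : ∀ z : ℂ, z.re = 1 → ‖F z‖ ≤ b) {t : ℝ} (h0 : 0 ≤ t) (h1 : t ≤ 1) :
    ‖F t‖ ≤ a ^ (1 - t) * b ^ t := by
  have := Complex.HadamardThreeLines.norm_le_interp_of_mem_verticalClosedStrip' (f := F) (z := t)
    (a := a) (b := b) zero_lt_one ⟨by simpa, by simpa⟩ hF.diffContOnCl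
    ⟨B, by rintro _ ⟨z, hz, rfl⟩; exact hB z hz.1 hz.2⟩ ha hb
  simpa using this

/-- Hölder's inequality `|Tr (A B)| ≤ ‖A‖_q ‖B‖_q'` for the Schatten norms with
`1 / q + 1 / q' = 1`, with the second factor given as `B = D ^ (1 / q') W` for a contraction `W`.
The form covers `q = 1`, where `D ^ 0` is the projection to the support of `D`. -/
theorem norm_opTrace_holder (A : H →L[ℂ] H) {D W : H →L[ℂ] H} (hD : 0 ≤ D) (hW : ‖W‖ ≤ 1)
    {q : ℝ} (hq : 1 ≤ q) :
    ‖opTrace H (A * cpowSupp D (1 - 1 / q : ℝ) * W)‖ ≤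
      (opTrace H D).re ^ (1 - 1 / q) * (opTrace H (CFC.abs A ^ q)).re ^ (1 / q) := by
  have hq0 : 0 < q := by linarith
  obtain ⟨U, hU, hUA, -⟩ := exists_polar A
  set P := CFC.abs A ^ q with hP
  have hP0 : 0 ≤ P := CFC.rpow_nonneg
  have hPA : cpowSupp P (1 / q : ℝ) = CFC.abs A := cpowSupp_rpow_one_div (CFC.abs_nonneg A) hq0
  -- `F` interpolates between `Tr D` at `re z = 0` and `Tr P` at `re z = 1`.
  let F : ℂ → ℂ := fun z => opTrace H (U * cpowSupp P z * cpowSupp D (1 - z) * W)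
  have hF : Differentiable ℂ F := by
    have h1 := differentiable_cpowSupp P
    have h2 : Differentiable ℂ fun z => cpowSupp D (1 - z) :=
      (differentiable_cpowSupp D).comp (by fun_prop)
    exact (opTrace H).differentiable.comp ((((differentiable_const U).mul h1).mul h2).mul
      (differentiable_const W))
  have key := three_lines hF (a := (opTrace H D).re) (b := (opTrace H P).re)
    (B := ‖opTrace H‖ * (1 * (max 1 (‖P‖ * ‖(1 : H →L[ℂ] H)‖)) ^ (1 : ℝ) *
      (max 1 (‖D‖ * ‖(1 : H →L[ℂ] H)‖)) ^ (1 : ℝ) * 1))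
    (fun z h0 h1 => ?_) (fun z hz => ?_) (fun z hz => ?_) (t := 1 / q) (by positivity)
    (by rw [div_le_one hq0]; exact hq)
  · have e : U * cpowSupp P ((1 / q : ℝ) : ℂ) * cpowSupp D (1 - ((1 / q : ℝ) : ℂ)) * W
        = A * cpowSupp D (1 - 1 / q : ℝ) * W := by
      rw [hPA, hUA]; push_cast; rfl
    simp only [F] at key
    rwa [e] at key
  · refine (opTrace H).le_opNorm_of_le ?_
    have n1 := norm_cpowSupp_le hP0 z h0 h1
    have n2 := norm_cpowSupp_le hD (1 - z) (R := 1) (by simpa using h1) (by simpa using h0)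
    refine (norm_mul_le _ _).trans (mul_le_mul ((norm_mul_le _ _).trans (mul_le_mul
      ((norm_mul_le _ _).trans (mul_le_mul hU n1 (norm_nonneg _) zero_le_one)) n2
        (norm_nonneg _) ?_)) hW (norm_nonneg _) ?_) <;> positivity
  · have e : cpowSupp D (1 - z) = D * cpowSupp D (-z) := by
      rw [← cpowSupp_one_add hD, sub_eq_add_neg]
    have e2 : opTrace H (U * cpowSupp P z * cpowSupp D (1 - z) * W)
        = opTrace H (cpowSupp D (-z) * W * (U * cpowSupp P z) * D) := by
      rw [e, mul_assoc (cpowSupp D (-z) * W), opTrace_mul_comm (cpowSupp D (-z) * W)]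
      simp only [mul_assoc]
    simp only [F]
    rw [e2]
    refine norm_opTrace_mul_le hD ?_
    have n1 := norm_cpowSupp_le_one hP0 hz
    have n2 := norm_cpowSupp_le_one hD (z := -z) (by simpa using hz)
    exact (norm_mul_le _ _).trans (mul_le_one₀ ((norm_mul_le _ _).trans (mul_le_one₀ n2
      (norm_nonneg _) hW)) (norm_nonneg _) ((norm_mul_le _ _).trans (mul_le_one₀ hU
      (norm_nonneg _) n1)))
  · have e : cpowSupp P z = P * cpowSupp P (z - 1) := by
      rw [← cpowSupp_one_add hP0, add_sub_cancel]
    have e2 : opTrace H (U * cpowSupp P z * cpowSupp D (1 - z) * W)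
        = opTrace H (cpowSupp P (z - 1) * (cpowSupp D (1 - z) * W) * U * P) := by
      rw [e, mul_assoc _ U P, opTrace_mul_comm _ (U * P)]
      simp only [mul_assoc]
    simp only [F]
    rw [e2]
    refine norm_opTrace_mul_le hP0 ?_
    have n1 := norm_cpowSupp_le_one hP0 (z := z - 1) (by simp [hz])
    have n2 := norm_cpowSupp_le_one hD (z := 1 - z) (by simp [hz])
    exact (norm_mul_le _ _).trans (mul_le_one₀ ((norm_mul_le _ _).trans (mul_le_one₀ n1
      (norm_nonneg _) ((norm_mul_le _ _).trans (mul_le_one₀ n2 (norm_nonneg _) hW))))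
      (norm_nonneg _) hU)
end Trace

/-! ### Products with unitary swivels -/

section Swivel
variable {H : Type*} [NormedAddCommGroup H] [InnerProductSpace ℂ H] [CompleteSpace H]
  [FiniteDimensional ℂ H]

theorem opTrace_abs_rpow_nonneg (p : ℝ) (X : H →L[ℂ] H) : 0 ≤ (opTrace H (CFC.abs X ^ p)).re :=
  (opTrace_eq_re_of_nonneg CFC.rpow_nonneg).1

theorem schattenNorm_rpow {p : ℝ} (hp : p ≠ 0) (X : H →L[ℂ] H) :
    schattenNorm p X ^ p = (opTrace H (CFC.abs X ^ p)).re := by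
  rw [schattenNorm, ← opTrace_apply, ← Real.rpow_mul (opTrace_abs_rpow_nonneg p X),
    one_div_mul_cancel hp, Real.rpow_one]

theorem norm_list_prod_le {M : ℝ} (hM : 1 ≤ M) (l : List (H →L[ℂ] H)) (hl : ∀ x ∈ l, ‖x‖ ≤ M) :
    ‖l.prod‖ ≤ M ^ l.length := by
  induction l with
  | nil =>
    rw [List.prod_nil, List.length_nil, pow_zero]
    exact ContinuousLinearMap.norm_id_le
  | cons a l ih =>
    rw [List.prod_cons, List.length_cons, pow_succ']
    exact (norm_mul_le _ _).trans (mul_le_mul (hl a (by simp))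
      (ih fun x hx => hl x (by simp [hx])) (norm_nonneg _) (by linarith))

theorem differentiable_list_ofFn_prod {L : ℕ} {f : Fin L → ℂ → H →L[ℂ] H}
    (hf : ∀ i, Differentiable ℂ (f i)) :
    Differentiable ℂ fun z => (List.ofFn fun i => f i z).prod := by
  induction L with
  | zero => simp
  | succ n ih =>
    simp only [List.ofFn_succ, List.prod_cons]
    exact (hf 0).mul (ih fun i => hf i.succ)

theorem norm_unitary_le_one (u : unitary (H →L[ℂ] H)) : ‖(u : H →L[ℂ] H)‖ ≤ 1 := by
  have h : ‖(u : H →L[ℂ] H)‖ * ‖(u : H →L[ℂ] H)‖ ≤ 1 := by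
    rw [← CStarRing.norm_star_mul_self, Unitary.coe_star_mul_self]
    exact ContinuousLinearMap.norm_id_le (𝕜 := ℂ) (E := H)
  nlinarith [norm_nonneg (u : H →L[ℂ] H)]

theorem continuous_abs_rpow {p : ℝ} (hp : 0 ≤ p) :
    Continuous fun X : H →L[ℂ] H => CFC.abs X ^ p := by
  simp only [CFC.rpow_def]
  exact Continuous.cfc_nnreal_of_mem_nhdsSet (s := univ) _ Filter.univ_mem CFC.continuous_abs
    (fun X => CFC.abs_nonneg X) (NNReal.continuous_rpow_const hp).continuousOn

theorem isCompact_unitary_commutant (a : H →L[ℂ] H) :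
    IsCompact {u : H →L[ℂ] H | u ∈ unitary (H →L[ℂ] H) ∧ Commute u a} := by
  have : ProperSpace (H →L[ℂ] H) := FiniteDimensional.proper ℂ _
  refine Metric.isCompact_of_isClosed_isBounded ?_ ?_
  · have h1 : IsClosed {u : H →L[ℂ] H | star u * u = 1 ∧ u * star u = 1} :=
      (isClosed_eq (by fun_prop) (by fun_prop)).inter (isClosed_eq (by fun_prop) (by fun_prop))
    have h2 : IsClosed {u : H →L[ℂ] H | u * a = a * u} :=
      isClosed_eq (by fun_prop) (by fun_prop)
    exact h1.inter h2
  · exact isBounded_iff_forall_norm_le.mpr ⟨1, fun u hu => norm_unitary_le_one ⟨u, hu.1⟩⟩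

theorem isCompact_swivelValues {L : ℕ} (C : Fin L → H →L[ℂ] H) {p : ℝ} (hp : 0 < p) :
    IsCompact (swivelValues C p) := by
  let g : (Fin L → H →L[ℂ] H) → ℝ := fun V =>
    (opTrace H (CFC.abs (List.ofFn fun i => C i ^ (1 / p) * V i).prod ^ p)).re
  have hprod : Continuous fun V : Fin L → H →L[ℂ] H =>
      (List.ofFn fun i => C i ^ (1 / p) * V i).prod := by
    simp only [List.ofFn_eq_map]
    exact continuous_list_prod _ fun i _ => continuous_const.mul (continuous_apply i)
  have hg : Continuous g :=
    Complex.continuous_re.comp ((opTrace H).continuous.comp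
      ((continuous_abs_rpow hp.le).comp hprod))
  have h : swivelValues C p = g ''
      univ.pi fun i => {u : H →L[ℂ] H | u ∈ unitary (H →L[ℂ] H) ∧ Commute u (C i)} := by
    ext x
    constructor
    · rintro ⟨V, hV, rfl⟩
      exact ⟨fun i => V i, fun i _ => ⟨(V i).2, hV i⟩, (schattenNorm_rpow hp.ne' _).symm⟩
    · rintro ⟨V, hV, rfl⟩
      exact ⟨fun i => ⟨V i, (hV i (mem_univ i)).1⟩, fun i => (hV i (mem_univ i)).2,
        (schattenNorm_rpow hp.ne' _).symm⟩
  rw [h]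
  exact (isCompact_univ_pi fun i => isCompact_unitary_commutant (C i)).image hg

theorem swivelValues_nonempty {L : ℕ} (C : Fin L → H →L[ℂ] H) (p : ℝ) :
    (swivelValues C p).Nonempty :=
  ⟨_, fun _ => 1, fun i => Commute.one_left (C i), rfl⟩

theorem isGreatest_maxSwivel {L : ℕ} (C : Fin L → H →L[ℂ] H) {p : ℝ} (hp : 0 < p) :
    IsGreatest (swivelValues C p) (maxSwivel C p) :=
  (isCompact_swivelValues C hp).isGreatest_sSup (swivelValues_nonempty C p)

/-- The powers of `N` on the right combine to `N ^ (1 - 1 / p)`, and those of `M` to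
`M ^ (1 / p)`. -/
theorem le_of_le_interp {N M p q : ℝ} (hN : 0 ≤ N) (hM : 0 ≤ M) (hp : 0 < p) (hq : 0 < q)
    (h : N ≤ N ^ (1 - q / p) * (N ^ (1 - 1 / q) * M ^ (1 / q)) ^ (q / p)) : N ≤ M := by
  rcases hN.eq_or_lt with rfl | hN
  · exact hM
  rw [Real.mul_rpow (by positivity) (by positivity), ← Real.rpow_mul hN.le, ← Real.rpow_mul hM,
    ← mul_assoc, ← Real.rpow_add hN] at h
  have e1 : 1 - q / p + (1 - 1 / q) * (q / p) = 1 - 1 / p := by field_simp; ring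
  have e2 : 1 / q * (q / p) = 1 / p := by field_simp
  rw [e1, e2] at h
  have e3 : N = N ^ (1 - 1 / p) * N ^ (1 / p) := by
    rw [← Real.rpow_add hN, sub_add_cancel, Real.rpow_one]
  nth_rw 1 [e3] at h
  have h' := le_of_mul_le_mul_left h (by positivity)
  exact (Real.rpow_le_rpow_iff hN.le hM (by positivity)).mp h'

/-- The interpolation step: a bound `M` on `‖∏ C_i ^ (1 / q) V_i‖_q ^ q` for all admissible swivels
is also a bound for each larger exponent `p`. -/
theorem opTrace_swivelProduct_le {L : ℕ} {C : Fin L → H →L[ℂ] H} (hC : ∀ i, 0 ≤ C i)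
    {p q M : ℝ} (hq : 1 ≤ q) (hqp : q ≤ p)
    (hM : ∀ V : Fin L → unitary (H →L[ℂ] H), (∀ i, Commute (V i : H →L[ℂ] H) (C i)) →
      (opTrace H (CFC.abs (swivelProduct C q V) ^ q)).re ≤ M)
    (V : Fin L → unitary (H →L[ℂ] H)) (hV : ∀ i, Commute (V i : H →L[ℂ] H) (C i)) :
    (opTrace H (CFC.abs (swivelProduct C p V) ^ p)).re ≤ M := by
  have hq0 : 0 < q := by linarith
  have hp0 : 0 < p := by linarith
  have hM0 : 0 ≤ M := (opTrace_abs_rpow_nonneg q _).trans (hM V hV)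
  set X := swivelProduct C p V with hX
  obtain ⟨U, hU, -, hUX⟩ := exists_polar X
  have hU' : ‖star U‖ ≤ 1 := by rwa [norm_star]
  set D := CFC.abs X ^ p with hD
  have hD0 : 0 ≤ D := CFC.rpow_nonneg
  have hDX : cpowSupp D (1 / p : ℝ) = CFC.abs X := cpowSupp_rpow_one_div (CFC.abs_nonneg X) hp0
  let G : ℂ → H →L[ℂ] H := fun z =>
    (List.ofFn fun i => cpowSupp (C i) (z / q) * (V i : H →L[ℂ] H)).prod
  let F : ℂ → ℂ := fun z => opTrace H (G z * cpowSupp D (1 - z / q) * star U)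
  have hzq (z : ℂ) : (z / q).re = z.re / q := Complex.div_ofReal_re z q
  have hG : Differentiable ℂ G := differentiable_list_ofFn_prod fun i =>
    ((differentiable_cpowSupp (C i)).comp (by fun_prop)).mul (differentiable_const _)
  have hF : Differentiable ℂ F := by
    have h2 : Differentiable ℂ fun z : ℂ => cpowSupp D (1 - z / q) :=
      (differentiable_cpowSupp D).comp (by fun_prop)
    exact (opTrace H).differentiable.comp ((hG.mul h2).mul (differentiable_const _))
  have hGbound {K : ℝ} (hK : 1 ≤ K) {z : ℂ} (h : ∀ i, ‖cpowSupp (C i) (z / q)‖ ≤ K) :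
      ‖G z‖ ≤ K ^ L := by
    have := norm_list_prod_le hK
        (List.ofFn fun i => cpowSupp (C i) (z / q) * (V i : H →L[ℂ] H)) fun x hx => by
      obtain ⟨i, rfl⟩ := (List.mem_ofFn' _ _).mp hx
      refine (norm_mul_le _ _).trans ?_
      have := mul_le_mul (h i) (norm_unitary_le_one (V i)) (norm_nonneg _) (by linarith)
      rwa [mul_one] at this
    rwa [List.length_ofFn] at this
  obtain ⟨K, hK⟩ := (Set.finite_range fun i =>
    (max 1 (‖C i‖ * ‖(1 : H →L[ℂ] H)‖)) ^ (1 : ℝ)).bddAbove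
  have hK' (i : Fin L) : (max 1 (‖C i‖ * ‖(1 : H →L[ℂ] H)‖)) ^ (1 : ℝ) ≤ max 1 K :=
    (hK ⟨i, rfl⟩).trans (le_max_right _ _)
  have key := three_lines hF (a := (opTrace H D).re)
    (b := (opTrace H D).re ^ (1 - 1 / q) * M ^ (1 / q))
    (B := ‖opTrace H‖ * ((max 1 K) ^ L *
      (max 1 (‖D‖ * ‖(1 : H →L[ℂ] H)‖)) ^ (1 : ℝ) * 1))
    (fun z h0 h1 => ?_) (fun z hz => ?_) (fun z hz => ?_) (t := q / p) (by positivity)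
    (by rw [div_le_one hp0]; exact hqp)
  -- The value of `F` at `q / p` is `Tr D`.
  · have e0 : ((q / p : ℝ) : ℂ) / q = ((1 / p : ℝ) : ℂ) := by
      have : (q : ℂ) ≠ 0 := by exact_mod_cast hq0.ne'
      push_cast
      field_simp
    have e1 : G (q / p : ℝ) = X := by
      simp only [G, e0, hX, swivelProduct]
      congr 2
      funext i
      rw [cpowSupp_ofReal (hC i) (by positivity)]
    have e2 : F (q / p : ℝ) = opTrace H D := by
      simp only [F, e1, e0]
      rw [opTrace_mul_comm, ← mul_assoc, hUX, ← hDX, cpowSupp_mul_cpowSupp, add_sub_cancel,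
        cpowSupp_one hD0]
    rw [e2, (opTrace_eq_re_of_nonneg hD0).2, Complex.norm_real,
      Real.norm_of_nonneg (opTrace_eq_re_of_nonneg hD0).1, Complex.ofReal_re] at key
    exact le_of_le_interp (opTrace_eq_re_of_nonneg hD0).1 hM0 hp0 hq0 key
  -- Boundedness of `F` on the strip.
  · have h0' : 0 ≤ (z / q).re := by rw [hzq]; positivity
    have h1' : (z / q).re ≤ 1 := by rw [hzq, div_le_one hq0]; linarith
    refine (opTrace H).le_opNorm_of_le ?_
    have n1 := hGbound (le_max_left 1 K) (z := z) fun i =>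
      (norm_cpowSupp_le (hC i) _ h0' h1').trans (hK' i)
    have n2 := norm_cpowSupp_le hD0 (1 - z / q) (R := 1) (by simpa using h1') (by simpa using h0')
    refine (norm_mul_le _ _).trans (mul_le_mul ((norm_mul_le _ _).trans (mul_le_mul n1 n2
      (norm_nonneg _) ?_)) hU' (norm_nonneg _) ?_) <;> positivity
  -- The line `re z = 0`: move `D` to the right end of the trace; what precedes it is a contraction.
  · have hz' : (z / q).re = 0 := by rw [hzq, hz, zero_div]
    have e2 : F z = opTrace H (cpowSupp D (-(z / q)) * star U * G z * D) := by
      simp only [F]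
      rw [sub_eq_add_neg, cpowSupp_one_add hD0, ← mul_assoc, mul_assoc (G z * D),
        opTrace_mul_comm (G z * D), mul_assoc _ (G z) D]
    rw [e2]
    refine norm_opTrace_mul_le hD0 ?_
    have n1 := hGbound le_rfl (z := z) fun i => norm_cpowSupp_le_one (hC i) hz'
    rw [one_pow] at n1
    have n2 := norm_cpowSupp_le_one hD0 (z := -(z / q)) (by rw [Complex.neg_re, hz', neg_zero])
    exact (norm_mul_le _ _).trans (mul_le_one₀ ((norm_mul_le _ _).trans (mul_le_one₀ n2
      (norm_nonneg _) hU')) (norm_nonneg _) n1)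
  -- The line `re z = 1`: the phases of the `C_i` are absorbed into the swivels.
  · have hz' : (z / q).re = 1 / q := by rw [hzq, hz]
    choose u hu hGu using fun i => exists_unitary_cpowSupp (hC i) (one_div_pos.mpr hq0) hz'
    have e1 : G z = swivelProduct C q fun i => u i * V i := by
      simp only [G, swivelProduct, hGu, Submonoid.coe_mul, mul_assoc]
    have e2 : cpowSupp D (1 - z / q) =
        cpowSupp D (1 - 1 / q : ℝ) * cpowSupp D ((1 / q : ℝ) - z / q) := by
      rw [cpowSupp_mul_cpowSupp]
      congr 1
      push_cast
      ring
    have n2 := norm_cpowSupp_le_one hD0 (z := (1 / q : ℝ) - z / q)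
      (by rw [Complex.sub_re, hz', Complex.ofReal_re, sub_self])
    simp only [F]
    rw [e1, e2, ← mul_assoc, mul_assoc _ _ (star U)]
    refine (norm_opTrace_holder _ hD0 ((norm_mul_le _ _).trans
      (mul_le_one₀ n2 (norm_nonneg _) hU')) hq).trans ?_
    have hT := hM (fun i => u i * V i) fun i => by
      simpa using (hu i).mul_left (hV i)
    have := Real.rpow_le_rpow (opTrace_abs_rpow_nonneg q _) hT (one_div_pos.mpr hq0).le
    gcongr
    exact Real.rpow_nonneg (opTrace_eq_re_of_nonneg hD0).1 _

end Swivel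

end

/-- For positive semi-definite operators on a finite-dimensional Hilbert space, the maximum over
the commuting unitary swivels is attained for each `p ≥ 1`, and it is non-increasing in `p`. -/
theorem theorem1 {H : Type*} [NormedAddCommGroup H] [InnerProductSpace ℂ H] [CompleteSpace H]
    [FiniteDimensional ℂ H] (L : ℕ) (C : Fin L → H →L[ℂ] H) (hC : ∀ i, (C i).IsPositive) :
    (∀ p : ℝ, 1 ≤ p → IsGreatest (swivelValues C p) (maxSwivel C p)) ∧
      AntitoneOn (maxSwivel C) (Set.Ici 1) := by
  refine ⟨fun p hp => isGreatest_maxSwivel C (by linarith), fun q hq p hp hqp => ?_⟩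
  have hq1 : 1 ≤ q := hq
  have hp1 : 1 ≤ p := hp
  obtain ⟨V, hV, hpV⟩ := (isGreatest_maxSwivel C (p := p) (by linarith)).1
  rw [hpV, schattenNorm_rpow (by linarith)]
  refine opTrace_swivelProduct_le (q := q)
    (fun i => (ContinuousLinearMap.nonneg_iff_isPositive _).mpr (hC i)) hq1 hqp
    (fun W hW => ?_) V hV
  rw [← schattenNorm_rpow (by linarith)]
  exact (isGreatest_maxSwivel C (p := q) (by linarith)).2 ⟨W, hW, rfl⟩
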